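/- Let $n\ge 1$ and $m\ge 0$, let $[n]$ be a set of $n$ agents and $[m]$ a set of $m$ indivisible items, and let every agent $i\in[n]$ have a valuation $v_i:2^{[m]}\to\mathbb{R}_{\ge 0}$ that is monotone ($v_i(S)\le v_i(T)$ whenever $S\subseteq T$) and subadditive ($v_i(S\cup T)\le v_i(S)+v_i(T)$ for all $S,T\subseteq[m]$). An allocation $X=(X_1,\dots,X_n)$ is a family of pairwise disjoint subsets of $[m]$; it is complete if $\bigcup_{i} X_i=[m]$. Its Nash welfare is $\mathrm{NW}(X)=\prod_{i\in[n]}v_i(X_i)^{1/n}$. An allocation $X$ is $\alpha$-EFX if $v_i(X_i)\ge\alpha\, v_i(X_j\setminus\{g\})$ for all $i,j\in[n]$ and all $g\in X_j$, and it is $\beta$-MNW if $\mathrm{NW}(X)\ge\beta\cdot\max_Y\mathrm{NW}(Y)$, where the maximum is over all (complete or partial) allocations $Y$. Then for every real $\alpha$ with $0\le\alpha\le\frac12$ there exists a complete allocation that is both $\alpha$-EFX and $\frac{1}{\alpha+1}$-MNW. -/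

import Mathlib

/-- A valuation `f` of sets of items is subadditive if `f (S ∪ T) ≤ f S + f T` for all,
not necessarily disjoint, sets `S` and `T`. -/
def IsSubadditive {m : ℕ} (f : Finset (Fin m) → ℝ) : Prop :=
  ∀ S T : Finset (Fin m), f (S ∪ T) ≤ f S + f T

/-- An allocation of the items `Fin m` to the agents `Fin n`: agent `i` gets the bundle `X i`,
and the bundles are pairwise disjoint. Some items may be left unallocated. -/
def IsAllocation {n m : ℕ} (X : Fin n → Finset (Fin m)) : Prop :=
  ∀ i j : Fin n, i ≠ j → Disjoint (X i) (X j)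

/-- A complete allocation is an allocation that assigns every item. -/
def IsCompleteAllocation {n m : ℕ} (X : Fin n → Finset (Fin m)) : Prop :=
  IsAllocation X ∧ Finset.univ.biUnion X = Finset.univ

/-- The Nash welfare: the geometric mean of the values of the agents for their bundles. -/
noncomputable def nashWelfare {n m : ℕ} (v : Fin n → Finset (Fin m) → ℝ)
    (X : Fin n → Finset (Fin m)) : ℝ :=
  ∏ i : Fin n, (v i (X i)) ^ ((1 : ℝ) / (n : ℝ))

/-- A maximum Nash welfare allocation: it maximizes the Nash welfare among all allocations,
partial ones included. -/
def IsMNW {n m : ℕ} (v : Fin n → Finset (Fin m) → ℝ) (X : Fin n → Finset (Fin m)) : Prop :=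
  IsAllocation X ∧
    ∀ Y : Fin n → Finset (Fin m), IsAllocation Y → nashWelfare v Y ≤ nashWelfare v X

/-- `Z` is `β`-MNW if its Nash welfare is at least `β` times the maximum Nash welfare. -/
def IsApproxMNW {n m : ℕ} (v : Fin n → Finset (Fin m) → ℝ) (β : ℝ)
    (Z : Fin n → Finset (Fin m)) : Prop :=
  ∃ X : Fin n → Finset (Fin m), IsMNW v X ∧ nashWelfare v Z ≥ β * nashWelfare v X

/-- `X` is `α`-EFX if `v i (X i) ≥ α * v i (X j - g)` for all agents `i`, `j` and every item
`g` of `X j`. -/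
def IsApproxEFX {n m : ℕ} (v : Fin n → Finset (Fin m) → ℝ) (α : ℝ)
    (X : Fin n → Finset (Fin m)) : Prop :=
  ∀ i j : Fin n, ∀ g ∈ X j, v i (X i) ≥ α * v i ((X j).erase g)

/-! Let `c = 1 / (α + 1)`, so that `c + α * c = 1`. For `α > 0`, the bundles of a maximum Nash
welfare allocation are trimmed until no agent wants a bundle in play minus an item, that is, values
it at more than `1 / α` times everything it has. An agent `l` that does want such a set gains a
factor `1 / α` by taking it, and this gain pays for the damage.

If the set is `core j` minus an item and `j` still values it at `c * floor j` or more, then `l`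
takes it and `j` can fall back to a factor `c`. If `l` has no float and wants a part `S` of a base
that is worth less than `c * floor b` to its agent `b`, subadditivity leaves `b` at least `α * c *
floor b`, and `S` leaves the base for good as the float of `l`. Choosing `S` best for `l` among the
small sets ensures that a holder of a float wants no small set again.

Finally every agent keeps the best bundle that it owns, or its core if it owns none. With `t` floats
and `p` owned cores, the floors have cost `(α * c) ^ t`, the ownership gains are worth `α⁻¹ ^ (t +
p)`, and at most `n + p - t` agents lose a factor `c`. Hence the product retains a factor `c ^ n *
(c / α) ^ p`, which is at least `c ^ n` because `α ≤ c`.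

The remaining items are placed without hurting anyone: an α-EFX allocation maximal for total value,
then for the number of items, must be complete (`exists_improvement`). This is where the threshold
`1 / 2` originates. -/

/-- Sorted by value, separated bundles grow by a factor `1 / α` at each step, so owning `k` of them
makes the best one worth `α⁻¹ ^ k` times the base level `b`. -/
theorem exists_max_of_separated {ι : Type*} [DecidableEq ι] (w : ι → ℝ) {b α : ℝ}
    (h0 : 0 ≤ α) (s : Finset ι) (hs : s.Nonempty)
    (hb : ∀ e ∈ s, b ≤ α * w e)
    (hsep : ∀ e ∈ s, ∀ e' ∈ s, e ≠ e' → w e ≤ α * w e' ∨ w e' ≤ α * w e) :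
    ∃ e ∈ s, (∀ e' ∈ s, w e' ≤ w e) ∧ b ≤ α ^ s.card * w e := by
  induction hk : s.card generalizing s with
  | zero => simp_all
  | succ k ih =>
    obtain ⟨e, he, hmax⟩ := s.exists_max_image w hs
    refine ⟨e, he, hmax, ?_⟩
    have hcard : (s.erase e).card = k := by rw [Finset.card_erase_of_mem he, hk]; rfl
    rcases (s.erase e).eq_empty_or_nonempty with h | h
    · rw [h] at hcard
      have : k = 0 := by simpa using hcard.symm
      subst this
      simpa using hb e he
    · obtain ⟨e', he', -, hbe'⟩ := ih (s.erase e) h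
        (fun x hx => hb x (Finset.mem_of_mem_erase hx))
        (fun x hx y hy => hsep x (Finset.mem_of_mem_erase hx) y (Finset.mem_of_mem_erase hy)) hcard
      have hs' := Finset.mem_of_mem_erase he'
      have hle : w e' ≤ α * w e := by
        rcases hsep e he e' hs' (Finset.ne_of_mem_erase he').symm with h | h
        · calc w e' ≤ w e := hmax e' hs'
            _ ≤ α * w e' := h
            _ ≤ α * w e := mul_le_mul_of_nonneg_left (hmax e' hs') h0
        · exact h
      calc b ≤ α ^ k * w e' := hbe'
        _ ≤ α ^ k * (α * w e) := mul_le_mul_of_nonneg_left hle (pow_nonneg h0 k)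
        _ = α ^ (k + 1) * w e := by ring

/-! ### Configurations of the trimming procedure -/

/-- A configuration of the trimming procedure. Agent `i` starts from the bundle `base i`, currently
trimmed to `core i`, and has the guaranteed value `floor i`. A bundle split off from a base for good
is a float; `float i` is the one that belongs to agent `i`. The set `own i` lists what agent `i` has
acquired: `none` stands for its float, and `some j` for the core of agent `j`. -/
structure TrimConfig (n m : ℕ) where
  base : Fin n → Finset (Fin m)
  core : Fin n → Finset (Fin m)
  float : Fin n → Finset (Fin m)
  own : Fin n → Finset (Option (Fin n))
  floor : Fin n → ℝ

namespace TrimConfig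

variable {n m : ℕ}

/-- The bundle that an entry of `own i` stands for. -/
def bundle (s : TrimConfig n m) (i : Fin n) : Option (Fin n) → Finset (Fin m)
  | none => s.float i
  | some j => s.core j

/-- A set is small if it is part of a base and worth too little to its agent for a core, or if it is
a proper part of a float. -/
def Small (v : Fin n → Finset (Fin m) → ℝ) (c : ℝ) (s : TrimConfig n m)
    (S : Finset (Fin m)) : Prop :=
  (∃ b, S ⊆ s.base b ∧ v b S < c * s.floor b) ∨ ∃ p, S ⊂ s.float p

open Classical in
/-- The guaranteed value of the core of agent `i`. -/
noncomputable def level (c : ℝ) (s : TrimConfig n m) (i : Fin n) : ℝ :=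
  if s.core i = s.base i then s.floor i else c * s.floor i

/-- The bundles that agents may compare with their own. -/
def InPlay (s : TrimConfig n m) (Y : Finset (Fin m)) : Prop :=
  (∃ j, Y = s.core j) ∨ ∃ p, Y = s.float p

/-- Agent `i` prefers `S` by a factor of more than `1 / α` to all it has. -/
def Wants (v : Fin n → Finset (Fin m) → ℝ) (α : ℝ) (s : TrimConfig n m) (i : Fin n)
    (S : Finset (Fin m)) : Prop :=
  (∀ e ∈ s.own i, v i (s.bundle i e) < α * v i S) ∧ (s.own i = ∅ → v i (s.core i) < α * v i S)

/-- The agents with a float. -/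
def holders (s : TrimConfig n m) : Finset (Fin n) := Finset.univ.filter fun i => none ∈ s.own i

/-- The invariants of the trimming procedure. -/
structure Valid (v : Fin n → Finset (Fin m) → ℝ) (α c P : ℝ) (s : TrimConfig n m) : Prop where
  base_disj : ∀ i j, i ≠ j → Disjoint (s.base i) (s.base j)
  float_disj : ∀ i j, i ≠ j → Disjoint (s.float i) (s.float j)
  base_float_disj : ∀ i j, Disjoint (s.base i) (s.float j)
  core_sub : ∀ i, s.core i ⊆ s.base i
  floor_nonneg : ∀ i, 0 ≤ s.floor i
  floor_le : ∀ i, s.floor i ≤ v i (s.base i)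
  core_val : ∀ i, c * s.floor i ≤ v i (s.core i)
  float_empty : ∀ i, none ∉ s.own i → s.float i = ∅
  own_inj : ∀ i i' j, some j ∈ s.own i → some j ∈ s.own i' → i = i'
  sep : ∀ i, ∀ e ∈ s.own i, ∀ e' ∈ s.own i, e ≠ e' →
    v i (s.bundle i e) ≤ α * v i (s.bundle i e') ∨ v i (s.bundle i e') ≤ α * v i (s.bundle i e)
  level_le : ∀ i, ∀ e ∈ s.own i, s.level c i ≤ α * v i (s.bundle i e)
  holder_le : ∀ i, none ∈ s.own i → ∀ S, s.Small v c S → α * v i S ≤ v i (s.float i)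
  unowned : ∀ j, s.core j ≠ s.base j → (∀ i, some j ∉ s.own i) →
    s.own j = ∅ ∧ ∀ Y, s.InPlay Y → ∀ g ∈ Y, α * v j (Y.erase g) ≤ v j (s.core j)
  ledger : (α * c) ^ s.holders.card * P ≤ ∏ i, s.floor i

/-- Nobody wants a trimmed bundle in play, and nobody is without a bundle. -/
def Settled (v : Fin n → Finset (Fin m) → ℝ) (α : ℝ) (s : TrimConfig n m) : Prop :=
  (∀ i Y, s.InPlay Y → ∀ g ∈ Y, ¬ s.Wants v α i (Y.erase g)) ∧
    ∀ i j, s.own j = ∅ → some j ∉ s.own i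

/-- The number of items in play. -/
def size (s : TrimConfig n m) : ℕ :=
  (Finset.univ.biUnion s.core).card + (Finset.univ.biUnion s.float).card

/-- The termination measure of the trimming procedure. -/
def rank (s : TrimConfig n m) : ℕ ×ₗ ℕ ×ₗ ℕ :=
  toLex (n - s.holders.card, toLex (s.size, ∑ i, (s.own i).card))

section

variable {v : Fin n → Finset (Fin m) → ℝ} {α c P : ℝ} {s : TrimConfig n m}

theorem mem_holders {i : Fin n} : i ∈ s.holders ↔ none ∈ s.own i := by simp [holders]

theorem floor_le_level (hc1 : c ≤ 1) (hs : s.Valid v α c P) (i : Fin n) :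
    c * s.floor i ≤ s.level c i := by
  unfold level
  split_ifs
  · exact mul_le_of_le_one_left (hs.floor_nonneg i) hc1
  · exact le_rfl

theorem level_le_core (hs : s.Valid v α c P) (i : Fin n) : s.level c i ≤ v i (s.core i) := by
  unfold level
  split_ifs with h
  · rw [h]; exact hs.floor_le i
  · exact hs.core_val i

/-- This makes a newly acquired bundle satisfy the invariant `level_le`. -/
theorem Wants.level_le (hnonneg : ∀ i S, 0 ≤ v i S) (h1 : α ≤ 1) (hs : s.Valid v α c P)
    {i : Fin n} {S : Finset (Fin m)} (hw : s.Wants v α i S) : s.level c i ≤ α * v i S := by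
  rcases (s.own i).eq_empty_or_nonempty with h | ⟨e, he⟩
  · exact (level_le_core hs i).trans (hw.2 h).le
  · have h2 := hs.level_le i e he
    have h3 := hw.1 e he
    have h4 := mul_le_of_le_one_left (hnonneg i (s.bundle i e)) h1
    linarith

/-- An agent whose trimmed core is unowned has nothing else and wants nothing in play. So an agent
that acquires a bundle never leaves behind a trimmed core without an owner. -/
theorem not_unowned_of_wants (hs : s.Valid v α c P) {i : Fin n} {Y : Finset (Fin m)}
    (hY : s.InPlay Y) {g : Fin m} (hg : g ∈ Y) (hw : s.Wants v α i (Y.erase g))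
    (hi : s.core i ≠ s.base i) : ∃ k, some i ∈ s.own k := by
  by_contra! h
  obtain ⟨h1, h2⟩ := hs.unowned i hi h
  exact (hw.2 h1).not_ge (h2 Y hY g hg)

end

/-! ### The moves, their invariants and their effect on the rank -/

/-- Agent `j` takes its core back. -/
def reclaim (s : TrimConfig n m) (j : Fin n) : TrimConfig n m :=
  { s with own := fun i => (s.own i).erase (some j) }

/-- Agent `l` takes the core of agent `j` without the item `g`. -/
def takeCore (s : TrimConfig n m) (l j : Fin n) (g : Fin m) : TrimConfig n m :=
  { s with
    core := Function.update s.core j ((s.core j).erase g)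
    own := fun i => if i = l then insert (some j) (s.own i) else (s.own i).erase (some j) }

/-- Agent `l` takes the part `S` of the float of agent `q`. -/
def takeFloat (s : TrimConfig n m) (l q : Fin n) (S : Finset (Fin m)) : TrimConfig n m :=
  { s with
    float := Function.update (Function.update s.float q ∅) l S
    own := fun i => if i = l then insert none (s.own i) else
      if i = q then (s.own i).erase none else s.own i }

open Classical in
/-- Agent `l` takes the part `S` of the base of agent `b` as its float. -/
noncomputable def split (s : TrimConfig n m) (α c : ℝ) (l b : Fin n) (S : Finset (Fin m)) :
    TrimConfig n m where
  base := Function.update s.base b (s.base b \ S)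
  core := fun j => if j = b then s.base b \ S else
    if ∃ i, some j ∈ s.own i then s.core j else s.base j
  float := Function.update s.float l S
  own := fun i => if i = l then insert none ((s.own i).erase (some b)) else
    (s.own i).erase (some b)
  floor := Function.update s.floor b (α * c * s.floor b)

section

variable {v : Fin n → Finset (Fin m) → ℝ} {α c P : ℝ} {s : TrimConfig n m}

theorem reclaim_valid (hs : s.Valid v α c P) {j : Fin n} (hj : s.own j = ∅)
    (hc : ∀ Y, s.InPlay Y → ∀ g ∈ Y, ¬ s.Wants v α j (Y.erase g)) :
    (s.reclaim j).Valid v α c P where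
  base_disj := hs.base_disj
  float_disj := hs.float_disj
  base_float_disj := hs.base_float_disj
  core_sub := hs.core_sub
  floor_nonneg := hs.floor_nonneg
  floor_le := hs.floor_le
  core_val := hs.core_val
  float_empty i hi := hs.float_empty i (by simpa [reclaim] using hi)
  own_inj i i' k h h' := hs.own_inj i i' k (Finset.mem_of_mem_erase h) (Finset.mem_of_mem_erase h')
  sep i e he e' he' := hs.sep i e (Finset.mem_of_mem_erase he) e' (Finset.mem_of_mem_erase he')
  level_le i e he := hs.level_le i e (Finset.mem_of_mem_erase he)
  holder_le i hi := hs.holder_le i (Finset.mem_of_mem_erase hi)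
  unowned k hk hk' := by
    by_cases hkj : k = j
    · subst hkj
      refine ⟨by simp [reclaim, hj], fun Y hY g hg => ?_⟩
      by_contra! hlt
      exact hc Y hY g hg ⟨by simp [hj], fun _ => hlt⟩
    · obtain ⟨h1, h2⟩ := hs.unowned k hk (fun i hi => hk' i
        (Finset.mem_erase.2 ⟨by simpa using hkj, hi⟩))
      exact ⟨by simp [reclaim, h1], h2⟩
  ledger := by
    have : (s.reclaim j).holders = s.holders := by ext i; simp [holders, reclaim]
    rw [this]; exact hs.ledger

theorem reclaim_rank {i j : Fin n} (hi : some j ∈ s.own i) : (s.reclaim j).rank < s.rank := by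
  have h1 : (s.reclaim j).holders = s.holders := by ext i; simp [holders, reclaim]
  have h2 : (s.reclaim j).size = s.size := rfl
  have h3 : ∑ k, ((s.reclaim j).own k).card < ∑ k, (s.own k).card :=
    Finset.sum_lt_sum (fun k _ => Finset.card_le_card (Finset.erase_subset _ _))
      ⟨i, Finset.mem_univ i, Finset.card_erase_lt_of_mem hi⟩
  simp only [rank, h1, h2, Prod.Lex.toLex_lt_toLex]
  exact Or.inr ⟨trivial, Or.inr ⟨trivial, h3⟩⟩

theorem takeCore_rank (hs : s.Valid v α c P) {l j : Fin n} {g : Fin m} (hg : g ∈ s.core j) :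
    (s.takeCore l j g).rank < s.rank := by
  have h1 : (s.takeCore l j g).holders = s.holders := by
    ext i
    simp only [mem_holders, takeCore]
    split_ifs <;> simp
  have h2 : (s.takeCore l j g).size < s.size := by
    have : Finset.univ.biUnion (s.takeCore l j g).core ⊂ Finset.univ.biUnion s.core := by
      refine Finset.ssubset_iff_subset_ne.2 ⟨?_, fun h => ?_⟩
      · refine Finset.biUnion_mono fun i _ => ?_
        by_cases hi : i = j
        · subst hi; simp [takeCore, Finset.erase_subset]
        · simp [takeCore, hi]
      · have : g ∈ Finset.univ.biUnion (s.takeCore l j g).core := by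
          rw [h]; exact Finset.mem_biUnion.2 ⟨j, Finset.mem_univ _, hg⟩
        obtain ⟨i, -, hi⟩ := Finset.mem_biUnion.1 this
        by_cases hij : i = j
        · subst hij; simp [takeCore] at hi
        · simp only [takeCore, Function.update_of_ne hij] at hi
          exact Finset.disjoint_left.1 (hs.base_disj i j hij) (hs.core_sub i hi) (hs.core_sub j hg)
    have := Finset.card_lt_card this
    simpa [size, takeCore] using this
  simp only [rank, h1, Prod.Lex.toLex_lt_toLex]
  exact Or.inr ⟨trivial, Or.inl h2⟩

theorem takeFloat_holders {l q : Fin n} {S : Finset (Fin m)} (hl : none ∉ s.own l)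
    (hq : none ∈ s.own q) : (s.takeFloat l q S).holders.card = s.holders.card := by
  have hlq : l ≠ q := by rintro rfl; exact hl hq
  have : (s.takeFloat l q S).holders = insert l (s.holders.erase q) := by
    ext i
    simp only [mem_holders, takeFloat, Finset.mem_insert, Finset.mem_erase]
    split_ifs <;> simp_all
  rw [this, Finset.card_insert_of_notMem (by simp [mem_holders, hl]),
    Finset.card_erase_add_one (mem_holders.2 hq)]

/-- The float changes hands, so the number of holders is unchanged, while the items outside `S` drop
out of play. -/
theorem takeFloat_rank (hs : s.Valid v α c P) {l q : Fin n} {S : Finset (Fin m)}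
    (hl : none ∉ s.own l) (hq : none ∈ s.own q) (hS : S ⊂ s.float q) :
    (s.takeFloat l q S).rank < s.rank := by
  have h2 : (s.takeFloat l q S).size < s.size := by
    obtain ⟨hsub, x, hx, hxS⟩ := Finset.ssubset_iff_exists_cons_subset.1 hS |>.elim
      fun a ⟨ha, h⟩ => (⟨hS.1, a, h (Finset.mem_cons_self a S), ha⟩ :
        S ⊆ s.float q ∧ ∃ x, x ∈ s.float q ∧ x ∉ S)
    have : Finset.univ.biUnion (s.takeFloat l q S).float ⊂ Finset.univ.biUnion s.float := by
      refine Finset.ssubset_iff_subset_ne.2 ⟨?_, fun h => ?_⟩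
      · intro y hy
        obtain ⟨i, -, hi⟩ := Finset.mem_biUnion.1 hy
        simp only [takeFloat, Function.update_apply] at hi
        split_ifs at hi
        · exact Finset.mem_biUnion.2 ⟨q, Finset.mem_univ _, hsub hi⟩
        · simp at hi
        · exact Finset.mem_biUnion.2 ⟨i, Finset.mem_univ _, hi⟩
      · have : x ∈ Finset.univ.biUnion (s.takeFloat l q S).float := by
          rw [h]; exact Finset.mem_biUnion.2 ⟨q, Finset.mem_univ _, hx⟩
        obtain ⟨i, -, hi⟩ := Finset.mem_biUnion.1 this
        simp only [takeFloat, Function.update_apply] at hi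
        split_ifs at hi with h1 h2
        · exact hxS hi
        · simp at hi
        · exact Finset.disjoint_left.1 (hs.float_disj i q h2) hi hx
    have := Finset.card_lt_card this
    simpa [size, takeFloat] using this
  simp only [rank, takeFloat_holders hl hq, Prod.Lex.toLex_lt_toLex]
  exact Or.inr ⟨trivial, Or.inl h2⟩

theorem split_holders {l b : Fin n} {S : Finset (Fin m)} (hl : none ∉ s.own l) :
    (s.split α c l b S).holders.card = s.holders.card + 1 := by
  have : (s.split α c l b S).holders = insert l s.holders := by
    ext i
    simp only [mem_holders, split, Finset.mem_insert]
    split_ifs <;> simp_all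
  rw [this, Finset.card_insert_of_notMem (by simp [mem_holders, hl])]

theorem split_rank {l b : Fin n} {S : Finset (Fin m)} (hl : none ∉ s.own l) :
    (s.split α c l b S).rank < s.rank := by
  have h1 := split_holders (α := α) (c := c) (b := b) (S := S) hl
  -- Without this bound the truncated difference `n - s.holders.card` might not decrease.
  have h2 : (s.split α c l b S).holders.card ≤ n := by
    simpa using Finset.card_le_univ (s.split α c l b S).holders
  simp only [rank, Prod.Lex.toLex_lt_toLex]
  left
  omega

/-- Wanting is exactly separation from everything `l` owns, and a previous owner drops its entry, so
no surviving entry loses value. Bundles in play only shrink, which preserves `unowned`. -/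
theorem takeCore_valid (hnonneg : ∀ i S, 0 ≤ v i S) (h0 : 0 ≤ α) (h1 : α ≤ 1)
    (hc1 : c ≤ 1) (hmono : ∀ i, Monotone (v i))
    (hs : s.Valid v α c P) {l j : Fin n} {g : Fin m}
    (hg : g ∈ s.core j) (hw : s.Wants v α l ((s.core j).erase g))
    (hgood : c * s.floor j ≤ v j ((s.core j).erase g)) : (s.takeCore l j g).Valid v α c P := by
  have hcore : ∀ k, (s.takeCore l j g).core k ⊆ s.core k := by
    intro k
    by_cases hk : k = j
    · subst hk; simp [takeCore, Finset.erase_subset]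
    · simp [takeCore, hk]
  have hcj : (s.takeCore l j g).core j = (s.core j).erase g := by simp [takeCore]
  have hck : ∀ k, k ≠ j → (s.takeCore l j g).core k = s.core k := by
    intro k hk; simp [takeCore, hk]
  have hbundle : ∀ i e, e ≠ some j → (s.takeCore l j g).bundle i e = s.bundle i e := by
    intro i e he
    match e with
    | none => rfl
    | some k => exact hck k (by simpa using he)
  have hbj : ∀ i, (s.takeCore l j g).bundle i (some j) = (s.core j).erase g := fun i => hcj
  have hlj : some j ∉ s.own l := by
    intro h
    have h2 := hw.1 _ h
    have h3 : v l ((s.core j).erase g) ≤ v l (s.core j) := hmono l (Finset.erase_subset _ _)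
    have h4 := mul_le_of_le_one_left (hnonneg l ((s.core j).erase g)) h1
    have h5 : v l (s.bundle l (some j)) = v l (s.core j) := rfl
    linarith
  have hlevel : ∀ i, (s.takeCore l j g).level c i ≤ s.level c i := by
    intro i
    by_cases hi : i = j
    · subst hi
      have hne : (s.takeCore l i g).core i ≠ (s.takeCore l i g).base i := by
        rw [hcj]
        intro h
        have h2 : g ∈ (s.core i).erase g := by rw [h]; exact hs.core_sub i hg
        simp at h2
      have : (s.takeCore l i g).level c i = c * s.floor i := by
        rw [level, if_neg hne]; rfl
      rw [this]
      exact floor_le_level hc1 hs i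
    · have : (s.takeCore l j g).level c i = s.level c i := by
        simp only [level, hck i hi]; rfl
      exact this.le
  have hown : ∀ i, i ≠ l → (s.takeCore l j g).own i = (s.own i).erase (some j) := by
    intro i hi; simp [takeCore, hi]
  have hownl : (s.takeCore l j g).own l = insert (some j) (s.own l) := by simp [takeCore]
  have hnone : ∀ i, none ∈ (s.takeCore l j g).own i ↔ none ∈ s.own i := by
    intro i
    by_cases hi : i = l
    · subst hi; simp [hownl]
    · simp [hown i hi]
  refine ⟨hs.base_disj, hs.float_disj, hs.base_float_disj, fun i => (hcore i).trans (hs.core_sub i),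
    hs.floor_nonneg, hs.floor_le, ?_, ?_, ?_, ?_, ?_, ?_, ?_, ?_⟩
  · intro i
    by_cases hi : i = j
    · subst hi; rw [hcj]; exact hgood
    · rw [hck i hi]; exact hs.core_val i
  · intro i hi
    exact hs.float_empty i (by rwa [hnone] at hi)
  · intro i i' k hk hk'
    by_cases hkj : k = j
    · subst hkj
      have hl : ∀ i, some k ∈ (s.takeCore l k g).own i → i = l := by
        intro i hi
        by_contra hne
        rw [hown i hne] at hi
        simp at hi
      rw [hl i hk, hl i' hk']
    · have hl : ∀ i, some k ∈ (s.takeCore l j g).own i → some k ∈ s.own i := by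
        intro i hi
        by_cases hil : i = l
        · subst hil
          rw [hownl] at hi
          simpa [hkj] using hi
        · rw [hown i hil] at hi
          exact Finset.mem_of_mem_erase hi
      exact hs.own_inj i i' k (hl i hk) (hl i' hk')
  · intro i e he e' he' hne
    by_cases hi : i = l
    · subst hi
      rw [hownl] at he he'
      rcases Finset.mem_insert.1 he with rfl | he
      · rcases Finset.mem_insert.1 he' with rfl | he'
        · exact absurd rfl hne
        · right
          rw [hbj, hbundle i e' hne.symm]
          exact (hw.1 e' he').le
      · rcases Finset.mem_insert.1 he' with rfl | he'
        · left
          rw [hbj, hbundle i e hne]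
          exact (hw.1 e he).le
        · rw [hbundle i e (by rintro rfl; exact hlj he),
            hbundle i e' (by rintro rfl; exact hlj he')]
          exact hs.sep i e he e' he' hne
    · rw [hown i hi] at he he'
      rw [hbundle i e (Finset.ne_of_mem_erase he), hbundle i e' (Finset.ne_of_mem_erase he')]
      exact hs.sep i e (Finset.mem_of_mem_erase he) e' (Finset.mem_of_mem_erase he') hne
  · intro i e he
    refine (hlevel i).trans ?_
    by_cases hi : i = l
    · subst hi
      rw [hownl] at he
      rcases Finset.mem_insert.1 he with rfl | he
      · rw [hbj]; exact hw.level_le hnonneg h1 hs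
      · rw [hbundle i e (by rintro rfl; exact hlj he)]
        exact hs.level_le i e he
    · rw [hown i hi] at he
      rw [hbundle i e (Finset.ne_of_mem_erase he)]
      exact hs.level_le i e (Finset.mem_of_mem_erase he)
  · intro i hi S hS
    exact hs.holder_le i ((hnone i).1 hi) S hS
  · intro k hk hk'
    have hkj : k ≠ j := by
      rintro rfl
      exact hk' l (by simp [hownl])
    rw [hck k hkj] at hk ⊢
    have hun : ∀ i, some k ∉ s.own i := by
      intro i hi
      apply hk' i
      by_cases hil : i = l
      · subst hil; rw [hownl]; exact Finset.mem_insert_of_mem hi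
      · rw [hown i hil]; exact Finset.mem_erase.2 ⟨by simpa using hkj, hi⟩
    obtain ⟨h2, h3⟩ := hs.unowned k hk hun
    have hkl : k ≠ l := by
      rintro rfl
      obtain ⟨i, hi⟩ := not_unowned_of_wants hs (Or.inl ⟨j, rfl⟩) hg hw hk
      exact hun i hi
    refine ⟨by rw [hown k hkl, h2]; rfl, ?_⟩
    rintro Y (⟨q, rfl⟩ | ⟨p, rfl⟩) x hx
    · exact (mul_le_mul_of_nonneg_left (hmono k (Finset.erase_subset_erase x (hcore q))) h0).trans
        (h3 _ (Or.inl ⟨q, rfl⟩) x (hcore q hx))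
    · exact h3 _ (Or.inr ⟨p, rfl⟩) x hx
  · have : (s.takeCore l j g).holders = s.holders := by
      ext i; simp only [mem_holders, hnone]
    rw [this]; exact hs.ledger

/-- No new small sets appear, so `holder_le` persists for the old holders; for `l` it follows from
the maximality of `S`. -/
theorem takeFloat_valid (hnonneg : ∀ i S, 0 ≤ v i S) (h0 : 0 ≤ α) (h1 : α ≤ 1)
    (hmono : ∀ i, Monotone (v i))
    (hs : s.Valid v α c P) {l q : Fin n} {S : Finset (Fin m)}
    (hl : none ∉ s.own l) (hq : none ∈ s.own q) (hS : S ⊂ s.float q)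
    (hw : s.Wants v α l S)
    (htouch : s.core l ≠ s.base l → ∃ k, some l ∈ s.own k)
    (hmax : ∀ T, s.Small v c T → v l T ≤ v l S) : (s.takeFloat l q S).Valid v α c P := by
  have hlq : l ≠ q := by rintro rfl; exact hl hq
  have hfl : (s.takeFloat l q S).float l = S := by simp [takeFloat]
  have hfq : (s.takeFloat l q S).float q = ∅ := by simp [takeFloat, hlq.symm]
  have hfk : ∀ k, k ≠ l → k ≠ q → (s.takeFloat l q S).float k = s.float k := by
    intro k hk hk'; simp [takeFloat, hk, hk']
  have hownl : (s.takeFloat l q S).own l = insert none (s.own l) := by simp [takeFloat]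
  have hownq : (s.takeFloat l q S).own q = (s.own q).erase none := by simp [takeFloat, hlq.symm]
  have hownk : ∀ k, k ≠ l → k ≠ q → (s.takeFloat l q S).own k = s.own k := by
    intro k hk hk'; simp [takeFloat, hk, hk']
  have hfsub : ∀ k, ∃ p, (s.takeFloat l q S).float k ⊆ s.float p ∧ (k ≠ l → p = k) ∧
      (k = l → p = q) := by
    intro k
    by_cases hk : k = l
    · subst hk; exact ⟨q, by rw [hfl]; exact hS.1, by simp, by simp⟩
    · refine ⟨k, ?_, by simp, by simp [hk]⟩
      by_cases hk' : k = q
      · subst hk'; rw [hfq]; simp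
      · rw [hfk k hk hk']
  have hsome : ∀ i k, some k ∈ (s.takeFloat l q S).own i ↔ some k ∈ s.own i := by
    intro i k
    by_cases hi : i = l
    · subst hi; simp [hownl]
    · by_cases hi' : i = q
      · subst hi'; simp [hownq]
      · rw [hownk i hi hi']
  have hbs : ∀ i k, (s.takeFloat l q S).bundle i (some k) = s.bundle i (some k) := fun _ _ => rfl
  have hbl : (s.takeFloat l q S).bundle l none = S := hfl
  have hsmall : ∀ T, (s.takeFloat l q S).Small v c T → s.Small v c T := by
    rintro T (h | ⟨k, hk⟩)
    · exact Or.inl h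
    · obtain ⟨p, hp, -⟩ := hfsub k
      exact Or.inr ⟨p, lt_of_lt_of_le hk hp⟩
  have hother : ∀ i, i ≠ l → ∀ e ∈ (s.takeFloat l q S).own i,
      e ∈ s.own i ∧ (s.takeFloat l q S).bundle i e = s.bundle i e := by
    intro i hi e he
    match e with
    | some k => exact ⟨(hsome i k).1 he, rfl⟩
    | none =>
      by_cases hi' : i = q
      · subst hi'; rw [hownq] at he; simp at he
      · rw [hownk i hi hi'] at he
        exact ⟨he, hfk i hi hi'⟩
  refine ⟨hs.base_disj, ?_, ?_, hs.core_sub, hs.floor_nonneg, hs.floor_le, hs.core_val, ?_, ?_, ?_,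
    ?_, ?_, ?_, ?_⟩
  · have key : ∀ k, k ≠ l → Disjoint (s.takeFloat l q S |>.float l)
        (s.takeFloat l q S |>.float k) := by
      intro k hk
      by_cases hk' : k = q
      · subst hk'; rw [hfq]; simp
      · rw [hfl, hfk k hk hk']
        exact (hs.float_disj q k (Ne.symm hk')).mono_left hS.1
    intro i k hik
    by_cases hi : i = l
    · subst hi; exact key k hik.symm
    · by_cases hk : k = l
      · subst hk; exact (key i hi).symm
      · obtain ⟨p, hp, hp', -⟩ := hfsub i
        obtain ⟨p2, hp2, hp2', -⟩ := hfsub k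
        rw [hp' hi] at hp; rw [hp2' hk] at hp2
        exact (hs.float_disj i k hik).mono hp hp2
  · intro i k
    obtain ⟨p, hp, -⟩ := hfsub k
    exact (hs.base_float_disj i p).mono_right hp
  · intro i hi
    by_cases hil : i = l
    · subst hil; simp [hownl] at hi
    · by_cases hiq : i = q
      · subst hiq; exact hfq
      · rw [hownk i hil hiq] at hi
        rw [hfk i hil hiq]; exact hs.float_empty i hi
  · intro i i' k hk hk'
    exact hs.own_inj i i' k ((hsome i k).1 hk) ((hsome i' k).1 hk')
  · intro i e he e' he' hne
    by_cases hi : i = l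
    · subst hi
      rw [hownl, Finset.mem_insert] at he he'
      match e, e' with
      | none, none => exact absurd rfl hne
      | none, some k =>
        right
        rw [hbl]
        exact (hw.1 (some k) (by simpa using he')).le
      | some k, none =>
        left
        rw [hbl]
        exact (hw.1 (some k) (by simpa using he)).le
      | some k, some k' =>
        exact hs.sep i _ (by simpa using he) _ (by simpa using he') hne
    · obtain ⟨h2, h3⟩ := hother i hi e he
      obtain ⟨h4, h5⟩ := hother i hi e' he'
      rw [h3, h5]
      exact hs.sep i e h2 e' h4 hne
  · intro i e he
    change s.level c i ≤ _
    by_cases hi : i = l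
    · subst hi
      rw [hownl, Finset.mem_insert] at he
      match e with
      | none => rw [hbl]; exact hw.level_le hnonneg h1 hs
      | some k => exact hs.level_le i _ (by simpa using he)
    · obtain ⟨h2, h3⟩ := hother i hi e he
      rw [h3]
      exact hs.level_le i e h2
  · intro i hi T hT
    by_cases hil : i = l
    · subst hil
      rw [hfl]
      exact (mul_le_of_le_one_left (hnonneg i T) h1).trans (hmax T (hsmall T hT))
    · obtain ⟨h2, h3⟩ := hother i hil none hi
      have := hs.holder_le i h2 T (hsmall T hT)
      rwa [show (s.takeFloat l q S).float i = s.float i from h3]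
  · intro k hk hk'
    obtain ⟨h2, h3⟩ := hs.unowned k hk (fun i hi => hk' i ((hsome i k).2 hi))
    have hkl : k ≠ l := by
      rintro rfl
      obtain ⟨i, hi⟩ := htouch hk
      exact hk' i ((hsome i k).2 hi)
    have hkq : k ≠ q := by rintro rfl; rw [h2] at hq; simp at hq
    refine ⟨by rw [hownk k hkl hkq, h2], ?_⟩
    rintro Y (⟨p, rfl⟩ | ⟨p, rfl⟩) x hx
    · exact h3 _ (Or.inl ⟨p, rfl⟩) x hx
    · obtain ⟨p', hp', -⟩ := hfsub p
      exact (mul_le_mul_of_nonneg_left (hmono k (Finset.erase_subset_erase x hp')) h0).trans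
        (h3 _ (Or.inr ⟨p', rfl⟩) x (hp' hx))
  · rw [takeFloat_holders hl hq]
    exact hs.ledger

/-- The factor `α * c` lost by `floor b` matches the one new holder in the ledger. The new float may
be a bundle that agents with unowned trimmed cores want, so those cores are reset to their bases,
which makes `unowned` vacuous. The reset raises no level that matters, since such agents own
nothing. -/
theorem split_valid (hnonneg : ∀ i S, 0 ≤ v i S) (hα0 : 0 ≤ α) (h1 : α ≤ 1) (hc0 : 0 ≤ c)
    (hcα : c + α * c = 1) (hmono : ∀ i, Monotone (v i)) (hsub : ∀ i, IsSubadditive (v i))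
    (hs : s.Valid v α c P) {l b : Fin n} {S : Finset (Fin m)}
    (hl : none ∉ s.own l) (hS : S ⊆ s.base b) (hSb : v b S < c * s.floor b)
    (hw : s.Wants v α l S)
    (htouch : s.core l ≠ s.base l → ∃ k, some l ∈ s.own k)
    (hmax : ∀ T, s.Small v c T → v l T ≤ v l S) : (s.split α c l b S).Valid v α c P := by
  have hc1 : c ≤ 1 := by nlinarith
  have hαc : α * c ≤ c := mul_le_of_le_one_left hc0 h1
  have hαc1 : α * c ≤ 1 := hαc.trans hc1
  have hlevelw := hw.level_le hnonneg h1 hs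
  have hlb : l ≠ b := by
    rintro rfl
    have h2 := floor_le_level hc1 hs l
    have h3 := mul_le_of_le_one_left (hnonneg l S) h1
    linarith
  have hbb : (s.split α c l b S).base b = s.base b \ S := by simp [split]
  have hbk : ∀ k, k ≠ b → (s.split α c l b S).base k = s.base k := by
    intro k hk; simp [split, hk]
  have hbsub : ∀ k, (s.split α c l b S).base k ⊆ s.base k := by
    intro k
    by_cases hk : k = b
    · subst hk; rw [hbb]; exact Finset.sdiff_subset
    · rw [hbk k hk]
  have hcb : (s.split α c l b S).core b = s.base b \ S := by simp [split]
  have hck : ∀ k, k ≠ b → (∃ i, some k ∈ s.own i) → (s.split α c l b S).core k = s.core k := by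
    intro k hk hex; simp only [split, if_neg hk, if_pos hex]
  have hck' : ∀ k, k ≠ b → (¬ ∃ i, some k ∈ s.own i) →
      (s.split α c l b S).core k = s.base k := by
    intro k hk hex; simp only [split, if_neg hk, if_neg hex]
  have hfl : (s.split α c l b S).float l = S := by simp [split]
  have hfk : ∀ k, k ≠ l → (s.split α c l b S).float k = s.float k := by
    intro k hk; simp [split, hk]
  have hgb : (s.split α c l b S).floor b = α * c * s.floor b := by simp [split]
  have hgk : ∀ k, k ≠ b → (s.split α c l b S).floor k = s.floor k := by
    intro k hk; simp [split, hk]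
  have hsome : ∀ i k, some k ∈ (s.split α c l b S).own i ↔ k ≠ b ∧ some k ∈ s.own i := by
    intro i k
    simp only [split]
    split_ifs <;> simp
  have hnone : ∀ i, none ∈ (s.split α c l b S).own i ↔ i = l ∨ none ∈ s.own i := by
    intro i
    simp only [split]
    split_ifs with h <;> simp [h]
  -- Subadditivity: removing `S` costs `b` less than `c * floor b`, and `1 - c = α * c`.
  have hval : α * c * s.floor b ≤ v b (s.base b \ S) := by
    have h2 := hsub b (s.base b \ S) S
    rw [Finset.sdiff_union_of_subset hS] at h2
    have h3 := hs.floor_le b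
    have : s.floor b = c * s.floor b + α * c * s.floor b := by rw [← add_mul, hcα, one_mul]
    linarith
  have hsmall : ∀ T, (s.split α c l b S).Small v c T → s.Small v c T := by
    rintro T (⟨k, hk, hlt⟩ | ⟨p, hp⟩)
    · refine Or.inl ⟨k, hk.trans (hbsub k), hlt.trans_le ?_⟩
      by_cases hkb : k = b
      · subst hkb; rw [hgb]
        exact mul_le_mul_of_nonneg_left (mul_le_of_le_one_left (hs.floor_nonneg k) hαc1) hc0
      · rw [hgk k hkb]
    · by_cases hpl : p = l
      · subst hpl; rw [hfl] at hp
        exact Or.inl ⟨b, hp.1.trans hS, (hmono b hp.1).trans_lt hSb⟩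
      · rw [hfk p hpl] at hp
        exact Or.inr ⟨p, hp⟩
  have hbundle : ∀ i e, e ∈ (s.split α c l b S).own i → (i = l → e ≠ none) →
      e ∈ s.own i ∧ (s.split α c l b S).bundle i e = s.bundle i e := by
    intro i e he hne
    match e with
    | some k =>
      obtain ⟨h2, h3⟩ := (hsome i k).1 he
      exact ⟨h3, hck k h2 ⟨i, h3⟩⟩
    | none =>
      have hil : i ≠ l := fun h => hne h rfl
      exact ⟨((hnone i).1 he).resolve_left hil, hfk i hil⟩
  have hbl : (s.split α c l b S).bundle l none = S := hfl
  have hlevel : ∀ i, (∃ e, e ∈ (s.split α c l b S).own i) →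
      (s.split α c l b S).level c i ≤ s.level c i := by
    rintro i ⟨e, he⟩
    by_cases hib : i = b
    · subst hib
      have : (s.split α c l i S).level c i = α * c * s.floor i := by
        rw [level, if_pos (by rw [hcb, hbb]), hgb]
      rw [this]
      exact (mul_le_mul_of_nonneg_right hαc (hs.floor_nonneg i)).trans (floor_le_level hc1 hs i)
    · by_cases hex : ∃ k, some i ∈ s.own k
      · simp only [level, hck i hib hex, hbk i hib, hgk i hib]
        exact le_rfl
      · have hcore : s.core i = s.base i := by
          by_contra hne
          by_cases hil : i = l
          · subst hil; exact hex (htouch hne)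
          · obtain ⟨h2, -⟩ := hs.unowned i hne (fun k hk => hex ⟨k, hk⟩)
            have := (hbundle i e he (fun h => absurd h hil)).1
            rw [h2] at this; simp at this
        simp only [level, hck' i hib hex, hbk i hib, hgk i hib, hcore]
        exact le_rfl
  refine ⟨?_, ?_, ?_, ?_, ?_, ?_, ?_, ?_, ?_, ?_, ?_, ?_, ?_, ?_⟩
  · intro i k hik
    exact (hs.base_disj i k hik).mono (hbsub i) (hbsub k)
  · have key : ∀ k, k ≠ l → Disjoint (s.split α c l b S |>.float l)
        (s.split α c l b S |>.float k) := by
      intro k hk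
      rw [hfl, hfk k hk]
      exact (hs.base_float_disj b k).mono_left hS
    intro i k hik
    by_cases hi : i = l
    · subst hi; exact key k hik.symm
    · by_cases hk : k = l
      · subst hk; exact (key i hi).symm
      · rw [hfk i hi, hfk k hk]; exact hs.float_disj i k hik
  · intro i k
    by_cases hk : k = l
    · subst hk
      rw [hfl]
      by_cases hi : i = b
      · subst hi; rw [hbb]; exact Finset.sdiff_disjoint
      · rw [hbk i hi]
        exact (hs.base_disj i b hi).mono_right hS
    · rw [hfk k hk]
      exact (hs.base_float_disj i k).mono_left (hbsub i)
  · intro i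
    by_cases hi : i = b
    · subst hi; rw [hcb, hbb]
    · by_cases hex : ∃ k, some i ∈ s.own k
      · rw [hck i hi hex, hbk i hi]; exact hs.core_sub i
      · rw [hck' i hi hex, hbk i hi]
  · intro i
    by_cases hi : i = b
    · subst hi; rw [hgb]; exact mul_nonneg (mul_nonneg hα0 hc0) (hs.floor_nonneg i)
    · rw [hgk i hi]; exact hs.floor_nonneg i
  · intro i
    by_cases hi : i = b
    · subst hi; rw [hgb, hbb]; exact hval
    · rw [hgk i hi, hbk i hi]; exact hs.floor_le i
  · intro i
    by_cases hi : i = b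
    · subst hi; rw [hgb, hcb]
      exact (mul_le_of_le_one_left
        (mul_nonneg (mul_nonneg hα0 hc0) (hs.floor_nonneg i)) hc1).trans hval
    · rw [hgk i hi]
      by_cases hex : ∃ k, some i ∈ s.own k
      · rw [hck i hi hex]; exact hs.core_val i
      · rw [hck' i hi hex]
        exact (mul_le_of_le_one_left (hs.floor_nonneg i) hc1).trans (hs.floor_le i)
  · intro i hi
    rw [hnone, not_or] at hi
    rw [hfk i hi.1]
    exact hs.float_empty i hi.2
  · intro i i' k hk hk'
    exact hs.own_inj i i' k ((hsome i k).1 hk).2 ((hsome i' k).1 hk').2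
  · intro i e he e' he' hne
    by_cases hcase : i = l ∧ e = none
    · obtain ⟨rfl, rfl⟩ := hcase
      obtain ⟨h2, h3⟩ := hbundle i e' he' (fun _ => hne.symm)
      right
      rw [h3, hbl]
      exact (hw.1 e' h2).le
    · obtain ⟨h2, h3⟩ := hbundle i e he (fun h h' => hcase ⟨h, h'⟩)
      by_cases hcase' : i = l ∧ e' = none
      · obtain ⟨rfl, rfl⟩ := hcase'
        left
        rw [h3, hbl]
        exact (hw.1 e h2).le
      · obtain ⟨h4, h5⟩ := hbundle i e' he' (fun h h' => hcase' ⟨h, h'⟩)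
        rw [h3, h5]
        exact hs.sep i e h2 e' h4 hne
  · intro i e he
    refine (hlevel i ⟨e, he⟩).trans ?_
    by_cases hcase : i = l ∧ e = none
    · obtain ⟨rfl, rfl⟩ := hcase
      rw [hbl]; exact hlevelw
    · obtain ⟨h2, h3⟩ := hbundle i e he (fun h h' => hcase ⟨h, h'⟩)
      rw [h3]; exact hs.level_le i e h2
  · intro i hi T hT
    by_cases hil : i = l
    · subst hil
      rw [hfl]
      exact (mul_le_of_le_one_left (hnonneg i T) h1).trans (hmax T (hsmall T hT))
    · rw [hfk i hil]
      exact hs.holder_le i (((hnone i).1 hi).resolve_left hil) T (hsmall T hT)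
  · intro k hk hk'
    exfalso
    apply hk
    by_cases hkb : k = b
    · subst hkb; rw [hcb, hbb]
    · have hex : ¬ ∃ i, some k ∈ s.own i := by
        rintro ⟨i, hi⟩
        exact hk' i ((hsome i k).2 ⟨hkb, hi⟩)
      rw [hck' k hkb hex, hbk k hkb]
  · rw [split_holders hl]
    have : ∏ i, (s.split α c l b S).floor i = α * c * ∏ i, s.floor i := by
      simp only [split]
      rw [Finset.prod_update_of_mem (Finset.mem_univ b), mul_assoc,
        Finset.sdiff_singleton_eq_erase, Finset.mul_prod_erase _ _ (Finset.mem_univ b)]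
    rw [this, pow_succ, mul_comm _ (α * c), mul_assoc]
    exact mul_le_mul_of_nonneg_left hs.ledger (mul_nonneg hα0 hc0)

/-! ### Progress and termination -/

theorem exists_rank_lt (hnonneg : ∀ i S, 0 ≤ v i S) (h0 : 0 ≤ α) (h1 : α ≤ 1) (hc0 : 0 ≤ c)
    (hcα : c + α * c = 1) (hmono : ∀ i, Monotone (v i)) (hsub : ∀ i, IsSubadditive (v i))
    (hs : s.Valid v α c P) (hns : ¬ s.Settled v α) :
    ∃ s' : TrimConfig n m, s'.Valid v α c P ∧ s'.rank < s.rank := by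
  classical
  have hc1 : c ≤ 1 := by nlinarith
  by_cases hwant : ∀ i Y, s.InPlay Y → ∀ g ∈ Y, ¬ s.Wants v α i (Y.erase g)
  · have : ¬ ∀ i j, s.own j = ∅ → some j ∉ s.own i := fun h => hns ⟨hwant, h⟩
    push Not at this
    obtain ⟨i, j, hj, hij⟩ := this
    exact ⟨s.reclaim j, reclaim_valid hs hj (hwant j), reclaim_rank hij⟩
  push Not at hwant
  obtain ⟨l, Y, hY, g, hg, hw⟩ := hwant
  have htouch : s.core l ≠ s.base l → ∃ k, some l ∈ s.own k := not_unowned_of_wants hs hY hg hw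
  by_cases hsm : none ∉ s.own l ∧ ∃ S, s.Small v c S ∧ s.Wants v α l S
  · obtain ⟨hl, S₀, hS₀, hwS₀⟩ := hsm
    obtain ⟨S, hS, hmax⟩ := Finset.exists_max_image
      (Finset.univ.filter fun S => s.Small v c S) (v l) ⟨S₀, by simpa using hS₀⟩
    simp only [Finset.mem_filter, Finset.mem_univ, true_and] at hS hmax
    have hle : α * v l S₀ ≤ α * v l S := mul_le_mul_of_nonneg_left (hmax S₀ hS₀) h0
    have hwS : s.Wants v α l S :=
      ⟨fun e he => (hwS₀.1 e he).trans_le hle, fun h => (hwS₀.2 h).trans_le hle⟩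
    rcases hS with ⟨b, hSb, hlt⟩ | ⟨q, hSq⟩
    · exact ⟨s.split α c l b S, split_valid hnonneg h0 h1 hc0 hcα hmono hsub hs hl hSb hlt hwS
        htouch hmax, split_rank hl⟩
    · have hq : none ∈ s.own q := by
        by_contra h
        rw [hs.float_empty q h] at hSq
        exact absurd hSq (Finset.not_ssubset_empty S)
      exact ⟨s.takeFloat l q S, takeFloat_valid hnonneg h0 h1 hmono hs hl hq hSq hwS htouch hmax,
        takeFloat_rank hs hl hq hSq⟩
  -- A holder cannot want a small set, and for other agents the previous case applies. Hence `Y` is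
  -- not a float, and if it is `core j`, agent `j` still values the trimmed core at `c * floor j` or
  -- more.
  · have hnot : ¬ s.Small v c (Y.erase g) := by
      intro h
      by_cases hl : none ∈ s.own l
      · exact (hw.1 none hl).not_ge (hs.holder_le l hl _ h)
      · exact hsm ⟨hl, _, h, hw⟩
    rcases hY with ⟨j, rfl⟩ | ⟨p, rfl⟩
    · refine ⟨s.takeCore l j g, takeCore_valid hnonneg h0 h1 hc1 hmono hs hg hw ?_,
        takeCore_rank hs hg⟩
      by_contra! hlt
      exact hnot (Or.inl ⟨j, (Finset.erase_subset _ _).trans (hs.core_sub j), hlt⟩)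
    · exact absurd (Or.inr ⟨p, Finset.erase_ssubset hg⟩) hnot

theorem exists_settled (hnonneg : ∀ i S, 0 ≤ v i S) (h0 : 0 ≤ α) (h1 : α ≤ 1) (hc0 : 0 ≤ c)
    (hcα : c + α * c = 1) (hmono : ∀ i, Monotone (v i)) (hsub : ∀ i, IsSubadditive (v i))
    (s : TrimConfig n m) (hs : s.Valid v α c P) :
    ∃ s' : TrimConfig n m, s'.Valid v α c P ∧ s'.Settled v α := by
  induction h : s.rank using WellFoundedLT.induction generalizing s with
  | ind r ih =>
    by_cases hset : s.Settled v α
    · exact ⟨s, hs, hset⟩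
    · obtain ⟨s', hs', hlt⟩ := exists_rank_lt hnonneg h0 h1 hc0 hcα hmono hsub hs hset
      exact ih s'.rank (h ▸ hlt) s' hs' rfl

/-! ### Accounting in a settled configuration -/

/-- The number of cores that agent `i` owns. -/
def coreCount (s : TrimConfig n m) (i : Fin n) : ℕ := ∑ j, if some j ∈ s.own i then 1 else 0

theorem card_own (s : TrimConfig n m) (i : Fin n) :
    (s.own i).card = (if none ∈ s.own i then 1 else 0) + s.coreCount i := by
  rw [coreCount, ← Fintype.sum_option (fun e => if e ∈ s.own i then 1 else 0)]
  simp

open Classical in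
/-- The exponent of the factor `c` lost by agent `i`. -/
noncomputable def loss (s : TrimConfig n m) (i : Fin n) : ℕ :=
  if s.own i = ∅ ∨ s.core i ≠ s.base i then 1 else 0

/-- Agent by agent: a holder owns something, so it incurs a loss only if its core is trimmed, and
then `unowned` forces that core to have an owner. -/
theorem sum_loss_add_le (hs : s.Valid v α c P) :
    ∑ i, s.loss i + s.holders.card ≤ n + ∑ i, s.coreCount i := by
  classical
  have h1 : ∑ j, (if ∃ i, some j ∈ s.own i then 1 else 0) ≤ ∑ i, s.coreCount i := by
    simp only [coreCount]
    rw [Finset.sum_comm]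
    refine Finset.sum_le_sum fun j _ => ?_
    split_ifs with h
    · obtain ⟨i, hi⟩ := h
      calc 1 = if some j ∈ s.own i then 1 else 0 := by rw [if_pos hi]
        _ ≤ _ := Finset.single_le_sum (f := fun i => if some j ∈ s.own i then 1 else 0)
          (fun _ _ => Nat.zero_le _) (Finset.mem_univ i)
    · exact Nat.zero_le _
  have h2 : s.holders.card = ∑ i, if none ∈ s.own i then 1 else 0 := by simp [holders]
  have h3 : ∑ i, (s.loss i + if none ∈ s.own i then 1 else 0) ≤
      ∑ i : Fin n, (1 + if ∃ k, some i ∈ s.own k then 1 else 0) := by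
    refine Finset.sum_le_sum fun i _ => ?_
    unfold loss
    by_cases he : s.own i = ∅
    · simp [he]
    · by_cases hc : s.core i = s.base i
      · simp only [he, hc, ne_eq, not_true_eq_false, or_self, if_false]
        split_ifs <;> omega
      · have hex : ∃ k, some i ∈ s.own k := by
          by_contra! h
          exact he (hs.unowned i hc h).1
        rw [if_pos hex]
        split_ifs <;> omega
  rw [Finset.sum_add_distrib, Finset.sum_add_distrib, ← h2] at h3
  simp only [Finset.sum_const, Finset.card_univ, Fintype.card_fin, smul_eq_mul, mul_one] at h3
  omega

theorem prod_bound (hα : 0 < α) (hαc : α ≤ c) (hc1 : c ≤ 1) (hP : 0 ≤ P)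
    (hs : s.Valid v α c P) (w : Fin n → ℝ) (hw0 : ∀ i, 0 ≤ w i)
    (hw : ∀ i, c ^ s.loss i * s.floor i ≤ α ^ (s.own i).card * w i) :
    c ^ n * P ≤ ∏ i, w i := by
  have hc0 : 0 < c := hα.trans_le hαc
  have h1 : ∏ i, (c ^ s.loss i * s.floor i) ≤ ∏ i, (α ^ (s.own i).card * w i) :=
    Finset.prod_le_prod (fun i _ => mul_nonneg (pow_nonneg hc0.le _) (hs.floor_nonneg i))
      (fun i _ => hw i)
  rw [Finset.prod_mul_distrib, Finset.prod_mul_distrib, Finset.prod_pow_eq_pow_sum,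
    Finset.prod_pow_eq_pow_sum] at h1
  set t := s.holders.card with ht
  set p := ∑ i, s.coreCount i with hp
  have hcard : ∑ i, (s.own i).card = t + p := by
    rw [hp, ht, Finset.sum_congr rfl (fun i _ => card_own s i), Finset.sum_add_distrib]
    simp [holders]
  have hloss := sum_loss_add_le hs
  rw [← ht, ← hp] at hloss
  rw [hcard] at h1
  have hw' : 0 ≤ ∏ i, w i := Finset.prod_nonneg fun i _ => hw0 i
  have h2 : c ^ (∑ i, s.loss i) * ((α * c) ^ t * P) ≤ α ^ (t + p) * ∏ i, w i :=
    (mul_le_mul_of_nonneg_left hs.ledger (pow_nonneg hc0.le _)).trans h1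
  -- The common factor replaces division by powers of `α` and `c`; cancelling it requires `α > 0`.
  have h3 : α ^ t * c ^ p * (c ^ n * P) ≤ α ^ t * c ^ p * ∏ i, w i := by
    calc α ^ t * c ^ p * (c ^ n * P) = α ^ t * P * c ^ (n + p) := by ring
      _ ≤ α ^ t * P * c ^ (∑ i, s.loss i + t) :=
          mul_le_mul_of_nonneg_left (pow_le_pow_of_le_one hc0.le hc1 hloss)
            (mul_nonneg (pow_nonneg hα.le _) hP)
      _ = c ^ (∑ i, s.loss i) * ((α * c) ^ t * P) := by rw [pow_add, mul_pow]; ring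
      _ ≤ α ^ (t + p) * ∏ i, w i := h2
      _ = α ^ t * (∏ i, w i) * α ^ p := by ring
      _ ≤ α ^ t * (∏ i, w i) * c ^ p :=
          mul_le_mul_of_nonneg_left (pow_le_pow_left₀ hα.le hαc p)
            (mul_nonneg (pow_nonneg hα.le _) hw')
      _ = α ^ t * c ^ p * ∏ i, w i := by ring
  exact le_of_mul_le_mul_left h3 (by positivity)

/-- A violation of α-EFX against the best owned bundle, or against the core of an agent owning
nothing, would be a want. Two agents cannot end with the same core: owners are unique, and nobody
owns the core of an agent without acquisitions. -/
theorem exists_approxEFX_of_settled (hnonneg : ∀ i S, 0 ≤ v i S) (hα : 0 < α)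
    (hαc : α ≤ c) (hc1 : c ≤ 1) (hP : 0 ≤ P) (hs : s.Valid v α c P) (hset : s.Settled v α) :
    ∃ A : Fin n → Finset (Fin m), IsAllocation A ∧ IsApproxEFX v α A ∧
      c ^ n * P ≤ ∏ i, v i (A i) := by
  have hbest : ∀ i, (s.own i).Nonempty → ∃ e ∈ s.own i,
      (∀ e' ∈ s.own i, v i (s.bundle i e') ≤ v i (s.bundle i e)) ∧
      s.level c i ≤ α ^ (s.own i).card * v i (s.bundle i e) := fun i hi =>
    exists_max_of_separated (fun e => v i (s.bundle i e)) hα.le (s.own i) hi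
      (hs.level_le i) (hs.sep i)
  have hchoice : ∀ i, ∃ e : Option (Fin n),
      ((s.own i = ∅ ∧ e = some i) ∨ e ∈ s.own i) ∧
      (∀ e' ∈ s.own i, v i (s.bundle i e') ≤ v i (s.bundle i e)) ∧
      c ^ s.loss i * s.floor i ≤ α ^ (s.own i).card * v i (s.bundle i e) := by
    intro i
    rcases (s.own i).eq_empty_or_nonempty with h | h
    · refine ⟨some i, Or.inl ⟨h, rfl⟩, by simp [h], ?_⟩
      simpa [h, loss, bundle] using hs.core_val i
    · obtain ⟨e, he, hmax, hle⟩ := hbest i h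
      refine ⟨e, Or.inr he, hmax, le_trans ?_ hle⟩
      unfold loss level
      by_cases hc : s.core i = s.base i
      · simp [h.ne_empty, hc]
      · simp [hc]
  choose e he hmax hval using hchoice
  have hplay : ∀ i, s.InPlay (s.bundle i (e i)) := by
    intro i
    cases h : e i with
    | none => exact Or.inr ⟨i, rfl⟩
    | some j => exact Or.inl ⟨j, rfl⟩
  have hcore_disj : ∀ j k, j ≠ k → Disjoint (s.core j) (s.core k) := fun j k hjk =>
    (hs.base_disj j k hjk).mono (hs.core_sub j) (hs.core_sub k)
  refine ⟨fun i => s.bundle i (e i), ?_, ?_, ?_⟩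
  · intro i j hij
    have key : ∀ k, e i = some k → e j = some k → False := by
      intro k hik hjk
      have h1 := he i
      have h2 := he j
      rw [hik] at h1
      rw [hjk] at h2
      rcases h1 with ⟨h1, h1'⟩ | h1
      · obtain rfl : k = i := by simpa using h1'
        rcases h2 with ⟨-, h2'⟩ | h2
        · exact hij (by simpa using h2')
        · exact hset.2 j k h1 h2
      · rcases h2 with ⟨h2, h2'⟩ | h2
        · obtain rfl : k = j := by simpa using h2'
          exact hset.2 i k h2 h1
        · exact hij (hs.own_inj i j k h1 h2)
    change Disjoint (s.bundle i (e i)) (s.bundle j (e j))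
    cases hi : e i with
    | none =>
      cases hj : e j with
      | none => exact hs.float_disj i j hij
      | some k => exact ((hs.base_float_disj k i).mono_left (hs.core_sub k)).symm
    | some k =>
      cases hj : e j with
      | none => exact (hs.base_float_disj k j).mono_left (hs.core_sub k)
      | some k' => exact hcore_disj k k' (by rintro rfl; exact key k hi hj)
  · intro i j g hg
    have hnw := hset.1 i _ (hplay j) g hg
    by_contra! hlt
    refine hnw ⟨fun e' he' => (hmax i e' he').trans_lt hlt, fun h => ?_⟩
    rcases he i with ⟨-, h'⟩ | h'
    · rw [h'] at hlt; exact hlt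
    · rw [h] at h'; simp at h'
  · exact prod_bound hα hαc hc1 hP hs _ (fun i => hnonneg i _) hval

end

end TrimConfig

/-- Every allocation can be trimmed to an `α`-EFX allocation at the cost of a factor of at most
`α + 1` per agent. -/
theorem exists_approxEFX_prod {n m : ℕ} {v : Fin n → Finset (Fin m) → ℝ}
    (hnonneg : ∀ i S, 0 ≤ v i S) (hmono : ∀ i, Monotone (v i)) (hsub : ∀ i, IsSubadditive (v i))
    {α : ℝ} (h0 : 0 < α) (hα : α ≤ 1 / 2) {X : Fin n → Finset (Fin m)} (hX : IsAllocation X) :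
    ∃ A : Fin n → Finset (Fin m), IsAllocation A ∧ IsApproxEFX v α A ∧
      (1 / (α + 1)) ^ n * ∏ i, v i (X i) ≤ ∏ i, v i (A i) := by
  have h1 : α ≤ 1 := hα.trans (by norm_num)
  have hc0 : 0 ≤ 1 / (α + 1) := by positivity
  have hc1 : 1 / (α + 1) ≤ 1 := by rw [div_le_one (by linarith)]; linarith
  have hcα : 1 / (α + 1) + α * (1 / (α + 1)) = 1 := by field_simp; ring
  -- Equivalent to `α ^ 2 + α ≤ 1`, which is weaker than `α ≤ 1 / 2`.
  have hαc : α ≤ 1 / (α + 1) := by rw [le_div_iff₀ (by linarith)]; nlinarith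
  let s : TrimConfig n m := ⟨X, X, fun _ => ∅, fun _ => ∅, fun i => v i (X i)⟩
  have hs : s.Valid v α (1 / (α + 1)) (∏ i, v i (X i)) :=
    { base_disj := hX
      float_disj := by simp [s]
      base_float_disj := by simp [s]
      core_sub := by simp [s]
      floor_nonneg := fun i => hnonneg i _
      floor_le := fun i => le_rfl
      core_val := fun i => mul_le_of_le_one_left (hnonneg i _) hc1
      float_empty := by simp [s]
      own_inj := by simp [s]
      sep := by simp [s]
      level_le := by simp [s]
      holder_le := by simp [s]
      unowned := by simp [s]
      ledger := by simp [s, TrimConfig.holders] }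
  obtain ⟨s', hs', hset⟩ :=
    TrimConfig.exists_settled hnonneg h0.le h1 hc0 hcα hmono hsub s hs
  exact TrimConfig.exists_approxEFX_of_settled hnonneg h0 hαc hc1
    (Finset.prod_nonneg fun i _ => hnonneg i _) hs' hset

/-! ### Nash welfare -/

theorem nashWelfare_mono {n m : ℕ} {v : Fin n → Finset (Fin m) → ℝ} (hnonneg : ∀ i S, 0 ≤ v i S)
    {X Y : Fin n → Finset (Fin m)} (h : ∀ i, v i (X i) ≤ v i (Y i)) :
    nashWelfare v X ≤ nashWelfare v Y :=
  Finset.prod_le_prod (fun i _ => Real.rpow_nonneg (hnonneg i _) _)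
    (fun i _ => Real.rpow_le_rpow (hnonneg i _) (h i) (by positivity))

theorem nashWelfare_eq_prod_rpow {n m : ℕ} {v : Fin n → Finset (Fin m) → ℝ}
    (hnonneg : ∀ i S, 0 ≤ v i S) (X : Fin n → Finset (Fin m)) :
    nashWelfare v X = (∏ i, v i (X i)) ^ ((1 : ℝ) / n) :=
  Real.finsetProd_rpow _ _ (fun i _ => hnonneg i _) _

theorem mul_nashWelfare_le {n m : ℕ} (hn : 0 < n) {v : Fin n → Finset (Fin m) → ℝ}
    (hnonneg : ∀ i S, 0 ≤ v i S) {c : ℝ} (hc : 0 ≤ c) {X Y : Fin n → Finset (Fin m)}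
    (h : c ^ n * ∏ i, v i (X i) ≤ ∏ i, v i (Y i)) : c * nashWelfare v X ≤ nashWelfare v Y := by
  rw [nashWelfare_eq_prod_rpow hnonneg, nashWelfare_eq_prod_rpow hnonneg]
  have hX : 0 ≤ ∏ i, v i (X i) := Finset.prod_nonneg fun i _ => hnonneg i _
  have hcn : c = (c ^ n) ^ ((1 : ℝ) / n) := by
    rw [one_div, Real.pow_rpow_inv_natCast hc hn.ne']
  conv_lhs => rw [hcn]
  rw [← Real.mul_rpow (pow_nonneg hc n) hX]
  exact Real.rpow_le_rpow (mul_nonneg (pow_nonneg hc n) hX) h (by positivity)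

theorem exists_isMNW {n m : ℕ} (v : Fin n → Finset (Fin m) → ℝ) :
    ∃ X : Fin n → Finset (Fin m), IsMNW v X := by
  classical
  obtain ⟨X, hX, hmax⟩ := Finset.exists_max_image
    (Finset.univ.filter fun X : Fin n → Finset (Fin m) => IsAllocation X) (nashWelfare v)
    ⟨fun _ => ∅, Finset.mem_filter.2 ⟨Finset.mem_univ _, fun _ _ _ => Finset.disjoint_empty_left _⟩⟩
  simp only [Finset.mem_filter, Finset.mem_univ, true_and] at hX hmax
  exact ⟨X, hX, hmax⟩

/-! ### Completing a partial allocation -/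

section Completion

variable {n m : ℕ} {v : Fin n → Finset (Fin m) → ℝ} {α : ℝ} {Y : Fin n → Finset (Fin m)}

/-- `Z` is at least as good as `Y` for every agent and better in total value, or else allocates
more items. -/
def IsImprovement (v : Fin n → Finset (Fin m) → ℝ) (Y Z : Fin n → Finset (Fin m)) : Prop :=
  (∀ i, v i (Y i) ≤ v i (Z i)) ∧
    ((∃ i, v i (Y i) < v i (Z i)) ∨ ∑ i, (Y i).card < ∑ i, (Z i).card)

/-- Agent `k` swaps its bundle for `{g}`, which minus an item is empty and hence harmless. -/
theorem exists_improvement_of_singleton (hnonneg : ∀ i S, 0 ≤ v i S)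
    (hmono : ∀ i, Monotone (v i)) (h1 : α ≤ 1) (hY : IsAllocation Y) (hE : IsApproxEFX v α Y)
    {g : Fin m} (hg : ∀ i, g ∉ Y i) {k : Fin n} (hk : v k (Y k) < v k {g}) :
    ∃ Z, IsAllocation Z ∧ IsApproxEFX v α Z ∧ IsImprovement v Y Z := by
  have hle : ∀ i, v i (Y i) ≤ v i (Function.update Y k {g} i) := by
    intro i
    by_cases hi : i = k
    · subst hi; simpa using hk.le
    · simp [hi]
  refine ⟨Function.update Y k {g}, ?_, ?_, hle, Or.inl ⟨k, by simpa using hk⟩⟩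
  · intro i j hij
    by_cases hi : i = k
    · subst hi
      simp [Function.update_of_ne hij.symm, hg j]
    · by_cases hj : j = k
      · subst hj
        simp [Function.update_of_ne hi, hg i]
      · simpa [hi, hj] using hY i j hij
  · intro i j x hx
    refine le_trans ?_ (hle i)
    by_cases hj : j = k
    · subst hj
      obtain rfl : x = g := by simpa using hx
      simp only [Function.update_self, Finset.erase_singleton]
      exact (mul_le_of_le_one_left (hnonneg i ∅) h1).trans (hmono i (Finset.empty_subset _))
    · rw [Function.update_of_ne hj] at hx ⊢
      exact hE i j x hx

theorem exists_improvement_of_unenvied (hnonneg : ∀ i S, 0 ≤ v i S)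
    (hmono : ∀ i, Monotone (v i)) (hsub : ∀ i, IsSubadditive (v i)) (hα : α ≤ 1 / 2)
    (hY : IsAllocation Y) (hE : IsApproxEFX v α Y)
    {g : Fin m} (hg : ∀ i, g ∉ Y i) (hsmall : ∀ i, v i {g} ≤ v i (Y i)) {k : Fin n}
    (hk : ∀ i, v i (Y k) ≤ v i (Y i)) :
    ∃ Z, IsAllocation Z ∧ IsApproxEFX v α Z ∧ IsImprovement v Y Z := by
  have hsubset : ∀ i, Y i ⊆ Function.update Y k (insert g (Y k)) i := by
    intro i
    by_cases hi : i = k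
    · subst hi; simp
    · simp [hi]
  have hle : ∀ i, v i (Y i) ≤ v i (Function.update Y k (insert g (Y k)) i) := fun i =>
    hmono i (hsubset i)
  refine ⟨Function.update Y k (insert g (Y k)), ?_, ?_, hle, Or.inr ?_⟩
  · intro i j hij
    by_cases hi : i = k
    · subst hi
      rw [Function.update_self, Function.update_of_ne hij.symm, Finset.disjoint_insert_left]
      exact ⟨hg j, hY i j hij⟩
    · by_cases hj : j = k
      · subst hj
        rw [Function.update_self, Function.update_of_ne hi, Finset.disjoint_insert_right]
        exact ⟨hg i, hY i j hij⟩
      · simpa [hi, hj] using hY i j hij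
  · intro i j x hx
    refine le_trans ?_ (hle i)
    by_cases hj : j = k
    · subst hj
      rw [Function.update_self]
      have h2 : v i ((insert g (Y j)).erase x) ≤ v i ({g} ∪ Y j) := by
        rw [← Finset.insert_eq]; exact hmono i (Finset.erase_subset _ _)
      have h3 := hsub i {g} (Y j)
      have h4 := hsmall i
      have h5 := hk i
      -- Both `g` and the unenvied bundle are worth at most `v i (Y i)` to agent `i`, so their union
      -- is worth at most twice that.
      have h6 : α * v i ((insert g (Y j)).erase x) ≤ 1 / 2 * v i ((insert g (Y j)).erase x) :=
        mul_le_mul_of_nonneg_right hα (hnonneg i _)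
      linarith
    · rw [Function.update_of_ne hj] at hx ⊢
      exact hE i j x hx
  · refine Finset.sum_lt_sum (fun i _ => Finset.card_le_card (hsubset i)) ⟨k, Finset.mem_univ k, ?_⟩
    rw [Function.update_self, Finset.card_insert_of_notMem (hg k)]
    exact Nat.lt_succ_self _

/-- Let `φ k` envy `k`. On its periodic points `φ` is a bijection, so passing each bundle there to
its envier rotates envy cycles. Bundles are only permuted and no value drops, so α-EFX survives. -/
theorem exists_improvement_of_envied (hn : 0 < n) (hY : IsAllocation Y)
    (hE : IsApproxEFX v α Y) (henvy : ∀ k, ∃ i, v i (Y i) < v i (Y k)) :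
    ∃ Z, IsAllocation Z ∧ IsApproxEFX v α Z ∧ IsImprovement v Y Z := by
  classical
  choose φ hφ using henvy
  have hbij := Function.bijOn_periodicPts φ
  let f : Fin n → Fin n := fun j => if j ∈ Function.periodicPts φ then φ j else j
  have hinj : Function.Injective f := by
    intro a b hab
    by_cases ha : a ∈ Function.periodicPts φ <;> by_cases hb : b ∈ Function.periodicPts φ <;>
      simp only [f, ha, hb, if_true, if_false] at hab
    · exact hbij.injOn ha hb hab
    · exact absurd (hab ▸ hbij.mapsTo ha) hb
    · exact absurd (hab ▸ hbij.mapsTo hb) ha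
    · exact hab
  let σ : Equiv.Perm (Fin n) := Equiv.ofBijective f (Finite.injective_iff_bijective.1 hinj)
  have hσ : ∀ j, σ j = f j := fun _ => rfl
  have hle' : ∀ j, v (σ j) (Y (σ j)) ≤ v (σ j) (Y j) := by
    intro j
    rw [hσ]
    by_cases hj : j ∈ Function.periodicPts φ
    · simp only [f, hj, if_true]; exact (hφ j).le
    · simp [f, hj]
  have hle : ∀ i, v i (Y i) ≤ v i (Y (σ.symm i)) := by
    intro i
    simpa using hle' (σ.symm i)
  refine ⟨fun i => Y (σ.symm i), fun i j hij => hY _ _ (by simpa using hij),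
    fun i j x hx => (hE i (σ.symm j) x hx).trans (hle i), hle, Or.inl ?_⟩
  -- An orbit in a finite set repeats, so a periodic point exists and somebody gains strictly.
  obtain ⟨a, b, hab, heq⟩ := Finite.exists_ne_map_eq_of_infinite fun k : ℕ => φ^[k] ⟨0, hn⟩
  obtain ⟨x, hx⟩ : ∃ x, x ∈ Function.periodicPts φ := by
    wlog hlt : a < b generalizing a b
    · exact this b a hab.symm heq.symm (by omega)
    refine ⟨φ^[a] ⟨0, hn⟩, Function.mk_mem_periodicPts (Nat.sub_pos_of_lt hlt) ?_⟩
    change φ^[b - a] (φ^[a] ⟨0, hn⟩) = φ^[a] ⟨0, hn⟩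
    rw [← Function.iterate_add_apply, Nat.sub_add_cancel hlt.le]
    exact heq.symm
  refine ⟨σ x, ?_⟩
  have hfx : σ x = φ x := by rw [hσ]; simp [f, hx]
  simp only [Equiv.symm_apply_apply]
  rw [hfx]
  exact hφ x

theorem exists_improvement (hn : 0 < n) (hnonneg : ∀ i S, 0 ≤ v i S)
    (hmono : ∀ i, Monotone (v i)) (hsub : ∀ i, IsSubadditive (v i)) (hα : α ≤ 1 / 2)
    (hY : IsAllocation Y) (hE : IsApproxEFX v α Y) {g : Fin m} (hg : ∀ i, g ∉ Y i) :
    ∃ Z, IsAllocation Z ∧ IsApproxEFX v α Z ∧ IsImprovement v Y Z := by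
  by_cases hbig : ∃ k, v k (Y k) < v k {g}
  · obtain ⟨k, hk⟩ := hbig
    exact exists_improvement_of_singleton hnonneg hmono (hα.trans (by norm_num)) hY hE hg hk
  push Not at hbig
  by_cases henvy : ∃ k, ∀ i, v i (Y k) ≤ v i (Y i)
  · obtain ⟨k, hk⟩ := henvy
    exact exists_improvement_of_unenvied hnonneg hmono hsub hα hY hE hg hbig hk
  push Not at henvy
  exact exists_improvement_of_envied hn hY hE henvy

theorem exists_complete_approxEFX (hn : 0 < n) (hnonneg : ∀ i S, 0 ≤ v i S)
    (hmono : ∀ i, Monotone (v i)) (hsub : ∀ i, IsSubadditive (v i)) (hα : α ≤ 1 / 2)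
    (hY : IsAllocation Y) (hE : IsApproxEFX v α Y) :
    ∃ Z, IsCompleteAllocation Z ∧ IsApproxEFX v α Z ∧ nashWelfare v Y ≤ nashWelfare v Z := by
  classical
  obtain ⟨Z, hZ, hmax⟩ := Finset.exists_max_image
    (Finset.univ.filter fun Z : Fin n → Finset (Fin m) =>
      IsAllocation Z ∧ IsApproxEFX v α Z ∧ nashWelfare v Y ≤ nashWelfare v Z)
    (fun Z => toLex (∑ i, v i (Z i), ∑ i, (Z i).card)) ⟨Y, by simpa using ⟨hY, hE⟩⟩
  simp only [Finset.mem_filter, Finset.mem_univ, true_and] at hZ hmax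
  obtain ⟨hZA, hZE, hZN⟩ := hZ
  refine ⟨Z, ⟨hZA, ?_⟩, hZE, hZN⟩
  by_contra hne
  obtain ⟨g, hg⟩ : ∃ g, ∀ i, g ∉ Z i := by
    by_contra! h
    exact hne (Finset.eq_univ_of_forall fun g => by simpa using h g)
  obtain ⟨W, hWA, hWE, hle, hlt⟩ :=
    exists_improvement hn hnonneg hmono hsub hα hZA hZE hg
  have hWmax := hmax W ⟨hWA, hWE, hZN.trans (nashWelfare_mono hnonneg hle)⟩
  refine hWmax.not_gt ?_
  rw [Prod.Lex.toLex_lt_toLex]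
  rcases hlt with ⟨i, hi⟩ | hcard
  · exact Or.inl (Finset.sum_lt_sum (fun i _ => hle i) ⟨i, Finset.mem_univ i, hi⟩)
  · rcases (Finset.sum_le_sum fun i (_ : i ∈ Finset.univ) => hle i).lt_or_eq with h | h
    · exact Or.inl h
    · exact Or.inr ⟨h, hcard⟩

end Completion

/-! ### The main theorem -/

theorem theorem3 (n m : ℕ) (hn : 0 < n) (v : Fin n → Finset (Fin m) → ℝ)
    (hnonneg : ∀ (i : Fin n) (S : Finset (Fin m)), 0 ≤ v i S)
    (hmono : ∀ i : Fin n, Monotone (v i))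
    (hsub : ∀ i : Fin n, IsSubadditive (v i))
    (α : ℝ) (hα0 : 0 ≤ α) (hα : α ≤ 1 / 2) :
    ∃ X : Fin n → Finset (Fin m),
      IsCompleteAllocation X ∧ IsApproxEFX v α X ∧ IsApproxMNW v (1 / (α + 1)) X := by
  obtain ⟨X, hX⟩ := exists_isMNW v
  obtain ⟨Y, hY, hYE, hYN⟩ : ∃ Y, IsAllocation Y ∧ IsApproxEFX v α Y ∧
      1 / (α + 1) * nashWelfare v X ≤ nashWelfare v Y := by
    -- For `α = 0` the optimum itself works, as 0-EFX is nonnegativity and the factor is 1.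
    rcases hα0.eq_or_lt with rfl | hpos
    · exact ⟨X, hX.1, fun i j g _ => by simpa using hnonneg i (X i), by simp⟩
    · obtain ⟨Y, hY, hYE, hprod⟩ := exists_approxEFX_prod hnonneg hmono hsub hpos hα hX.1
      exact ⟨Y, hY, hYE, mul_nashWelfare_le hn hnonneg (by positivity) hprod⟩
  obtain ⟨Z, hZ, hZE, hZN⟩ := exists_complete_approxEFX hn hnonneg hmono hsub hα hY hYE
  exact ⟨Z, hZ, hZE, X, hX, hYN.trans hZN⟩
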